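/- Let $S\subset\mathbb{R}$ be a finite set of servers on the line, with capacities $c:S\to\mathbb{N}$. A request sequence is a finite sequence $\sigma=r_1\cdots r_n$ of reals with $n\le\sum_{s\in S}c(s)$. Requests arrive one by one; on arrival each request $r$ must be matched irrevocably, at cost $|r-s|$, with a server $s\in S$ that is free, i.e. has so far been matched with fewer than $c(s)$ requests. For an online algorithm $\mathcal{A}$, let $\mathcal{A}(\sigma|S)$ be its total cost on $\sigma$, and let $\mathrm{Opt}(\sigma|S)$ be the minimum total cost of a matching of all requests of $\sigma$ with servers in which each server $s$ is used at most $c(s)$ times. The algorithm $\mathcal{A}$ is $\rho$-competitive if $\mathcal{A}(\sigma|S)\le\rho\,\mathrm{Opt}(\sigma|S)$ for every request sequence $\sigma$. For $T=\{t_1<\dots<t_m\}$ with $m\ge2$ let $L(T)=\dfrac{t_m-t_1}{\max_u(t_{u+1}-t_u)}$, let $L(T)=0$ if $|T|\le1$, and let $\alpha(S)=\max_{T\subseteq S}L(T)$. The algorithm PTCP, $\mathcal{A}^*[S]$, matches a request $r$, when $F\subseteq S$ is the nonempty set of free servers, with the server $\mathcal{A}^*[S](r,F)$ defined recursively as follows.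 If $F=\{s\}$, then $\mathcal{A}^*[S](r,F)=s$. Otherwise write $S=\{s_1<\dots<s_k\}$ and let $(s_a,s_{a+1})$ be a largest gap, $s_{a+1}-s_a=\max_u(s_{u+1}-s_u)$, where for every set of servers one largest gap is fixed in advance, ties being broken arbitrarily. Put $S_1=\{s_1,\dots,s_a\}$, $S_2=\{s_{a+1},\dots,s_k\}$, $\Delta_1=s_a-s_1$, $\Delta_2=s_k-s_{a+1}$, $D=s_{a+1}-s_a$ and $x=\dfrac{\Delta_2+D}{(\Delta_1+D)+(\Delta_2+D)}\,D$. If ($r\le s_a+x$ and $F\cap S_1\neq\emptyset$) or $F\cap S_2=\emptyset$, then $\mathcal{A}^*[S](r,F)=\mathcal{A}^*[S_1](r,F\cap S_1)$; otherwise $\mathcal{A}^*[S](r,F)=\mathcal{A}^*[S_2](r,F\cap S_2)$. Theorem. For every finite $S\subset\mathbb{R}$, every capacity $c:S\to\mathbb{N}$ and every way of breaking ties between largest gaps, $\mathcal{A}^*[S]$ always chooses a free server, and it is $(2\alpha(S)+1)$-competitive. -/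

import Mathlib

/-- `u < v` are adjacent points of the finite set `T`: no point of `T` lies strictly between. -/
def AdjacentIn (T : Finset ℝ) (u v : ℝ) : Prop :=
  u ∈ T ∧ v ∈ T ∧ u < v ∧ ∀ w ∈ T, w ≤ u ∨ v ≤ w

/-- `(u, v)` is a largest gap of `T`: the points `u < v` are adjacent in `T` and no other pair of
adjacent points of `T` is farther apart. -/
def IsLargestGap (T : Finset ℝ) (u v : ℝ) : Prop :=
  AdjacentIn T u v ∧ ∀ u' v', AdjacentIn T u' v' → v' - u' ≤ v - u

/-- The largest distance between adjacent points of `T` (a maximum over a finite set, nonempty as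
soon as `T` has two points). -/
noncomputable def maxGap (T : Finset ℝ) : ℝ :=
  sSup {d : ℝ | ∃ u v, AdjacentIn T u v ∧ d = v - u}

/-- `(max T - min T) / maxGap T`, and `0` if `T` has at most one point. -/
noncomputable def diamGapRatio (T : Finset ℝ) : ℝ :=
  if h : 1 < T.card then
    (T.max' (Finset.card_pos.mp (by omega)) - T.min' (Finset.card_pos.mp (by omega))) / maxGap T
  else 0

/-- `α(S)`: the maximum of `diamGapRatio T` over all subsets `T` of `S`. -/
noncomputable def alphaRatio (S : Finset ℝ) : ℝ :=
  S.powerset.sup' (Finset.powerset_nonempty S) diamGapRatio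

/-! ### Online facility assignment on a line

A server is identified with its position, so a set of servers is a finite set of reals. A request
sequence is a list of reals. An algorithm is a rule `A : ℝ → Finset ℝ → ℝ` that gives, for a new
request `r` and the set `F` of currently free servers, the server `A r F` that `r` is matched with.
-/

/-- `A` is a legitimate rule for the servers `S`: it always picks a free server. -/
def IsOnlineRule (S : Finset ℝ) (A : ℝ → Finset ℝ → ℝ) : Prop :=
  ∀ (r : ℝ) (F : Finset ℝ), F ⊆ S → F.Nonempty → A r F ∈ F

/-- The free servers when `c s` is the remaining capacity of each server `s`. -/
def freeServers (S : Finset ℝ) (c : ℝ → ℕ) : Finset ℝ :=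
  S.filter fun s => 0 < c s

/-- The list of servers with which `A` matches the successive requests, when it starts with
remaining capacities `c`. -/
noncomputable def assignment (A : ℝ → Finset ℝ → ℝ) (S : Finset ℝ) :
    (ℝ → ℕ) → List ℝ → List ℝ
  | _, [] => []
  | c, r :: σ =>
    let s := A r (freeServers S c)
    s :: assignment A S (Function.update c s (c s - 1)) σ

/-- The cost of matching the `i`-th request of `σ` with the `i`-th server of `τ`, for all `i`. -/
noncomputable def matchingCost (σ τ : List ℝ) : ℝ :=
  (List.zipWith (fun r s => |r - s|) σ τ).sum

/-- `τ` matches every request of `σ` with a server of `S`, within the capacities `c`. -/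
def IsFeasible (S : Finset ℝ) (c : ℝ → ℕ) (σ τ : List ℝ) : Prop :=
  τ.length = σ.length ∧ (∀ s ∈ τ, s ∈ S) ∧ ∀ s ∈ S, τ.count s ≤ c s

/-- The cost `A(σ|S)` incurred by the online rule `A` on `σ`. -/
noncomputable def algCost (A : ℝ → Finset ℝ → ℝ) (S : Finset ℝ) (c : ℝ → ℕ) (σ : List ℝ) : ℝ :=
  matchingCost σ (assignment A S c σ)

/-- The optimal offline cost `Opt(σ|S)`: the minimum cost of a feasible matching. (There are
finitely many feasible `τ`, and at least one if `σ.length ≤ ∑ s ∈ S, c s`.) -/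
noncomputable def optCost (S : Finset ℝ) (c : ℝ → ℕ) (σ : List ℝ) : ℝ :=
  sInf {x : ℝ | ∃ τ, IsFeasible S c σ τ ∧ x = matchingCost σ τ}

/-- `A` is `ρ`-competitive (in the strict sense) for the servers `S` with capacities `c`; request
sequences are those whose length does not exceed the total capacity. -/
def IsCompetitive (S : Finset ℝ) (c : ℝ → ℕ) (A : ℝ → Finset ℝ → ℝ) (ρ : ℝ) : Prop :=
  ∀ σ : List ℝ, σ.length ≤ ∑ s ∈ S, c s → algCost A S c σ ≤ ρ * optCost S c σ

/-! ### The algorithm PTCP -/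

/-- The part of `S` up to `u`. -/
noncomputable def leftPart (S : Finset ℝ) (u : ℝ) : Finset ℝ := S.filter fun s => s ≤ u

/-- The part of `S` from `v` on. -/
noncomputable def rightPart (S : Finset ℝ) (v : ℝ) : Finset ℝ := S.filter fun s => v ≤ s

/-- The critical point `u + x` for the gap `(u, v)` of `S`, where
`x = (Δ₂ + D) / ((Δ₁ + D) + (Δ₂ + D)) * D` with `Δ₁ = u - min S`, `Δ₂ = max S - v`, `D = v - u`. -/
noncomputable def criticalPoint (S : Finset ℝ) (hS : S.Nonempty) (u v : ℝ) : ℝ :=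
  let Δ₁ := u - S.min' hS
  let Δ₂ := S.max' hS - v
  let D := v - u
  u + (Δ₂ + D) / ((Δ₁ + D) + (Δ₂ + D)) * D

/-- A rule `g` selecting one largest gap `((g T).1, (g T).2)` of every set `T` with at least two
points: it fixes how ties between largest gaps are broken. -/
def IsGapRule (g : Finset ℝ → ℝ × ℝ) : Prop :=
  ∀ T : Finset ℝ, 1 < T.card → IsLargestGap T (g T).1 (g T).2

theorem card_leftPart_lt {S : Finset ℝ} {u v : ℝ} (h : IsLargestGap S u v) :
    (leftPart S u).card < S.card :=
  Finset.card_lt_card (Finset.filter_ssubset.mpr ⟨v, h.1.2.1, not_le.mpr h.1.2.2.1⟩)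

theorem card_rightPart_lt {S : Finset ℝ} {u v : ℝ} (h : IsLargestGap S u v) :
    (rightPart S v).card < S.card :=
  Finset.card_lt_card (Finset.filter_ssubset.mpr ⟨u, h.1.1, not_le.mpr h.1.2.2.1⟩)

open Classical in
/-- PTCP for the servers `S`: the server with which a request `r` is matched when `F ⊆ S` is the
nonempty set of free servers. The last value `0` is never reached if `g` is a gap rule and
`F ⊆ S` is nonempty. -/
noncomputable def ptcp (g : Finset ℝ → ℝ × ℝ) (S : Finset ℝ) (r : ℝ) (F : Finset ℝ) : ℝ :=
  if hF : ∃ s, F = {s} then hF.choose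
  else if h : IsLargestGap S (g S).1 (g S).2 then
    if (r ≤ criticalPoint S ⟨_, h.1.1⟩ (g S).1 (g S).2 ∧ F ∩ leftPart S (g S).1 ≠ ∅) ∨
        F ∩ rightPart S (g S).2 = ∅ then
      ptcp g (leftPart S (g S).1) r (F ∩ leftPart S (g S).1)
    else
      ptcp g (rightPart S (g S).2) r (F ∩ rightPart S (g S).2)
  else 0
termination_by S.card
decreasing_by
  · exact card_leftPart_lt h
  · exact card_rightPart_lt h

/-!
Reserve for every request the server that an optimal matching gives it. After appending requests
that are located at servers, both PTCP and the reservation use up all capacities, so on either side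
of a largest gap they use equally many servers. Charge a request `r` with reserved server `o` by
`charge ρ m M r o`, which is at most `ρ * |r - o|`, and follow the recursion of PTCP: exchange the
reservations of the requests whose reserved server lies on the wrong side, and pass to the two
sides. The critical point is placed so that an exchange that moves a reservation from `o` to `o'`
changes the charge by at most `o' - o` (or always by at most `o - o'`, depending on the direction in
which requests overflow), and these differences add up to zero. On a single server the charge
is at least the cost of PTCP.
-/

section Charge

/-- The cost of travelling to an end of an interval of servers from a point at signed distance `x`
inwards from this end: `ρ * x` from inside and `-x` from outside. -/
noncomputable def travelCost (ρ x : ℝ) : ℝ := max (ρ * x) (-x)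

/-- The charge of a request `r` with reserved server `o`, when the servers lie in `[m, M]`: the
request travels to `o` directly, or by way of `m` or `M`, from where it continues at unit cost. -/
noncomputable def charge (ρ m M r o : ℝ) : ℝ :=
  min (ρ * |r - o|) (min (travelCost ρ (r - m) + (o - m)) (travelCost ρ (M - r) + (M - o)))

/-- `κ` is a threshold for the gap `(u, v)` of servers in `[m, u] ∪ [v, M]` for which requests that
overflow across `κ` are paid for by charges with parameter `ρ`. -/
structure IsBalancedThreshold (ρ m u κ v M : ℝ) : Prop where
  le_left : m ≤ u
  left_le : u ≤ κ
  left_lt_right : u < v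
  le_right : κ ≤ v
  right_le : v ≤ M
  overflow_left : 2 * (v - m) ≤ (ρ + 1) * (v - κ)
  overflow_right : 2 * (M - u) ≤ (ρ + 1) * (κ - u)

/-- The charge that remains after the servers in `[m, u] ∪ [v, M]` are split at the gap `(u, v)`: it
refers to the side on which the reserved server lies. -/
noncomputable def splitCharge (ρ m u v M r o : ℝ) : ℝ :=
  if o ≤ u then charge ρ m u r o else charge ρ v M r o

variable {ρ m u κ v M r o o' x y : ℝ}

theorem mul_le_travelCost : ρ * x ≤ travelCost ρ x := le_max_left _ _

theorem neg_le_travelCost : -x ≤ travelCost ρ x := le_max_right _ _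

theorem abs_le_travelCost (hρ : 1 ≤ ρ) : |x| ≤ travelCost ρ x := by
  rcases abs_cases x with ⟨hx, hx₀⟩ | ⟨hx, -⟩ <;> rw [hx]
  · exact (le_mul_of_one_le_left hx₀ hρ).trans mul_le_travelCost
  · exact neg_le_travelCost

theorem travelCost_le_mul_abs (hρ : 1 ≤ ρ) : travelCost ρ x ≤ ρ * |x| :=
  max_le (mul_le_mul_of_nonneg_left (le_abs_self x) (zero_le_one.trans hρ))
    ((neg_le_abs x).trans (le_mul_of_one_le_left (abs_nonneg x) hρ))

theorem travelCost_le_add_sub (hρ : 0 ≤ ρ) (hxy : x ≤ y) :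
    travelCost ρ x ≤ travelCost ρ y + (y - x) := by
  apply max_le
  · linarith [mul_le_mul_of_nonneg_left hxy hρ, mul_le_travelCost (ρ := ρ) (x := y)]
  · linarith [neg_le_travelCost (ρ := ρ) (x := y)]

theorem charge_le_mul_abs_sub : charge ρ m M r o ≤ ρ * |r - o| := min_le_left _ _

theorem charge_le_left : charge ρ m M r o ≤ travelCost ρ (r - m) + (o - m) :=
  (min_le_right _ _).trans (min_le_left _ _)

theorem charge_le_right : charge ρ m M r o ≤ travelCost ρ (M - r) + (M - o) :=
  (min_le_right _ _).trans (min_le_right _ _)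

theorem le_charge (hdirect : x ≤ ρ * |r - o|) (hleft : x ≤ travelCost ρ (r - m) + (o - m))
    (hright : x ≤ travelCost ρ (M - r) + (M - o)) : x ≤ charge ρ m M r o :=
  le_min hdirect (le_min hleft hright)

theorem charge_neg : charge ρ (-M) (-m) (-r) (-o) = charge ρ m M r o := by
  simp only [charge, neg_sub_neg, abs_sub_comm o r]
  congr 1
  exact min_comm _ _

theorem abs_sub_le_charge (hρ : 1 ≤ ρ) (hm : m ≤ o) (hM : o ≤ M) :
    |r - o| ≤ charge ρ m M r o := by
  refine le_charge (le_mul_of_one_le_left (abs_nonneg _) hρ) ?_ ?_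
  · calc |r - o| ≤ |r - m| + |m - o| := abs_sub_le _ _ _
      _ = |r - m| + (o - m) := by rw [abs_sub_comm m, abs_of_nonneg (sub_nonneg.mpr hm)]
      _ ≤ _ := by gcongr; exact abs_le_travelCost hρ
  · calc |r - o| ≤ |r - M| + |M - o| := abs_sub_le _ _ _
      _ = |M - r| + (M - o) := by rw [abs_sub_comm r, abs_of_nonneg (sub_nonneg.mpr hM)]
      _ ≤ _ := by gcongr; exact abs_le_travelCost hρ

theorem charge_le_of_le_right (hρ : 0 ≤ ρ) (huM : u ≤ M) : charge ρ m u r o ≤ charge ρ m M r o := by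
  refine le_charge charge_le_mul_abs_sub charge_le_left ?_
  linarith [charge_le_right (ρ := ρ) (m := m) (M := u) (r := r) (o := o),
    travelCost_le_add_sub hρ (sub_le_sub_right huM r)]

theorem charge_le_of_le_left (hρ : 0 ≤ ρ) (hmv : m ≤ v) : charge ρ v M r o ≤ charge ρ m M r o := by
  rw [← charge_neg (m := v), ← charge_neg (m := m)]
  exact charge_le_of_le_right hρ (neg_le_neg hmv)

theorem charge_right_sub_le (hρ : 1 ≤ ρ) (hmv : m ≤ v) (ho : o ≤ v) (ho' : v ≤ o') :
    charge ρ v M r o' - o' ≤ charge ρ m M r o - o := by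
  have hρ₀ : 0 ≤ ρ := zero_le_one.trans hρ
  have hleft : charge ρ v M r o' ≤ travelCost ρ (r - v) + (o' - v) := charge_le_left
  suffices charge ρ v M r o' - o' + o ≤ charge ρ m M r o by linarith
  refine le_charge ?_ ?_ ?_
  · linarith [travelCost_le_add_sub hρ₀ (sub_le_sub_left ho r),
      travelCost_le_mul_abs (x := r - o) hρ]
  · linarith [travelCost_le_add_sub hρ₀ (sub_le_sub_left hmv r)]
  · linarith [charge_le_right (ρ := ρ) (m := v) (M := M) (r := r) (o := o')]

namespace IsBalancedThreshold

variable (h : IsBalancedThreshold ρ m u κ v M)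
include h

theorem neg : IsBalancedThreshold ρ (-M) (-v) (-κ) (-u) (-m) where
  le_left := neg_le_neg h.right_le
  left_le := neg_le_neg h.le_right
  left_lt_right := neg_lt_neg h.left_lt_right
  le_right := neg_le_neg h.left_le
  right_le := neg_le_neg h.le_left
  overflow_left := by linarith [h.overflow_right]
  overflow_right := by linarith [h.overflow_left]

theorem lt_right : κ < v := by
  refine h.le_right.lt_of_ne fun hκ => ?_
  have hleft := h.overflow_left
  rw [hκ, sub_self, mul_zero] at hleft
  linarith [h.le_left, h.left_lt_right]

theorem one_le : 1 ≤ ρ := by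
  have hmul : 2 * (v - κ) ≤ (ρ + 1) * (v - κ) := by
    linarith [h.overflow_left, h.le_left, h.left_le]
  linarith [le_of_mul_le_mul_right hmul (sub_pos.mpr h.lt_right)]

theorem charge_left_sub_le (hr : r ≤ κ) (ho : o ∈ Set.Icc v M) (ho' : m ≤ o') :
    charge ρ m u r o' - o' ≤ charge ρ m M r o - o := by
  have hρ := h.one_le
  have hright : charge ρ m u r o' ≤ travelCost ρ (u - r) + (u - o') := charge_le_right
  have hκ : travelCost ρ (u - r) ≤ ρ * (v - r) - (u - m) - (v - m) := by
    apply max_le <;> nlinarith [h.overflow_left, h.le_left, h.left_le, h.left_lt_right]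
  have hρo : ρ * (v - r) + (o - v) ≤ ρ * (o - r) := by nlinarith [ho.1]
  have hρM : ρ * (v - r) + (M - v) ≤ ρ * (M - r) := by nlinarith [h.right_le]
  suffices charge ρ m u r o' - o' + o ≤ charge ρ m M r o by linarith
  refine le_charge ?_ ?_ ?_
  · have hdirect : ρ * (o - r) ≤ ρ * |r - o| := by
      rw [abs_sub_comm]
      exact mul_le_mul_of_nonneg_left (le_abs_self _) (zero_le_one.trans hρ)
    linarith
  · linarith [charge_le_left (ρ := ρ) (m := m) (M := u) (r := r) (o := o')]
  · linarith [mul_le_travelCost (ρ := ρ) (x := M - r), ho.2]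

theorem splitCharge_neg (ho : o ∈ Set.Icc m u ∪ Set.Icc v M) :
    splitCharge ρ (-M) (-v) (-u) (-m) (-r) (-o) = splitCharge ρ m u v M r o := by
  have huv := h.left_lt_right
  rcases ho with ho | ho
  · rw [splitCharge, splitCharge, if_neg (by linarith [ho.2]), if_pos ho.2, charge_neg]
  · rw [splitCharge, splitCharge, if_pos (neg_le_neg ho.1), if_neg (by linarith [ho.1]), charge_neg]

theorem splitCharge_sub_le (hr : o' ≤ u → r ≤ κ) (ho : o ∈ Set.Icc m u ∪ Set.Icc v M)
    (ho' : o' ∈ Set.Icc m u ∪ Set.Icc v M) (heq : (o' ≤ u ↔ o ≤ u) → o' = o) :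
    splitCharge ρ m u v M r o' - o' ≤ charge ρ m M r o - o := by
  have hρ := h.one_le
  have hρ₀ : 0 ≤ ρ := zero_le_one.trans hρ
  have huv := h.left_lt_right
  have hmv := h.le_left.trans huv.le
  unfold splitCharge
  rcases ho' with ho' | ho' <;> rcases ho with ho | ho
  · rw [heq ⟨fun _ => ho.2, fun _ => ho'.2⟩, if_pos ho.2]
    exact sub_le_sub_right (charge_le_of_le_right hρ₀ (huv.le.trans h.right_le)) o
  · rw [if_pos ho'.2]
    exact h.charge_left_sub_le (hr ho'.2) ho ho'.1
  · rw [if_neg (huv.trans_le ho'.1).not_ge]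
    exact charge_right_sub_le hρ hmv (ho.2.trans huv.le) ho'.1
  · have hou : ¬ o ≤ u := (huv.trans_le ho.1).not_ge
    have hou' : ¬ o' ≤ u := (huv.trans_le ho'.1).not_ge
    rw [heq (iff_of_false hou' hou), if_neg hou]
    exact sub_le_sub_right (charge_le_of_le_left hρ₀ hmv) o

theorem splitCharge_add_le (hr : u < o' → κ ≤ r) (ho : o ∈ Set.Icc m u ∪ Set.Icc v M)
    (ho' : o' ∈ Set.Icc m u ∪ Set.Icc v M) (heq : (o' ≤ u ↔ o ≤ u) → o' = o) :
    splitCharge ρ m u v M r o' + o' ≤ charge ρ m M r o + o := by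
  have huv := h.left_lt_right
  have hmem : ∀ {s}, s ∈ Set.Icc m u ∪ Set.Icc v M →
      -s ∈ Set.Icc (-M) (-v) ∪ Set.Icc (-u) (-m) := by
    rintro s (hs | hs)
    · exact Or.inr ⟨neg_le_neg hs.2, neg_le_neg hs.1⟩
    · exact Or.inl ⟨neg_le_neg hs.2, neg_le_neg hs.1⟩
  have hside : ∀ {s}, s ∈ Set.Icc m u ∪ Set.Icc v M → (-s ≤ -v ↔ ¬ s ≤ u) := by
    rintro s (hs | hs)
    · exact iff_of_false (by linarith [hs.2]) (not_not.mpr hs.2)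
    · exact iff_of_true (neg_le_neg hs.1) (huv.trans_le hs.1).not_ge
  have hneg := h.neg.splitCharge_sub_le (r := -r)
    (fun hs => neg_le_neg (hr (not_le.mp ((hside ho').mp hs)))) (hmem ho) (hmem ho')
    (fun hs => neg_inj.mpr (heq (by rwa [hside ho, hside ho', not_iff_not] at hs)))
  rwa [h.splitCharge_neg ho', charge_neg, sub_neg_eq_add, sub_neg_eq_add] at hneg

theorem sum_splitCharge_le {ι : Type*} {L : Finset ι} {r o o' : ι → ℝ}
    (hr : (∀ i ∈ L, o' i ≤ u → r i ≤ κ) ∨ ∀ i ∈ L, u < o' i → κ ≤ r i)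
    (ho : ∀ i ∈ L, o i ∈ Set.Icc m u ∪ Set.Icc v M)
    (ho' : ∀ i ∈ L, o' i ∈ Set.Icc m u ∪ Set.Icc v M)
    (heq : ∀ i ∈ L, (o' i ≤ u ↔ o i ≤ u) → o' i = o i) (hsum : ∑ i ∈ L, o' i = ∑ i ∈ L, o i) :
    ∑ i ∈ L, splitCharge ρ m u v M (r i) (o' i) ≤ ∑ i ∈ L, charge ρ m M (r i) (o i) := by
  rcases hr with hr | hr
  · have := Finset.sum_le_sum fun i hi =>
      h.splitCharge_sub_le (hr i hi) (ho i hi) (ho' i hi) (heq i hi)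
    rwa [Finset.sum_sub_distrib, Finset.sum_sub_distrib, hsum, sub_le_sub_iff_right] at this
  · have := Finset.sum_le_sum fun i hi =>
      h.splitCharge_add_le (hr i hi) (ho i hi) (ho' i hi) (heq i hi)
    rwa [Finset.sum_add_distrib, Finset.sum_add_distrib, hsum, add_le_add_iff_right] at this

end IsBalancedThreshold

end Charge

section Rearrangement

open Finset

variable {ι : Type*}

theorem exists_perm_of_card_eq {A B : Finset ι} (hcard : #A = #B) :
    ∃ e : Equiv.Perm ι, (∀ i, e i ∈ B ↔ i ∈ A) ∧ ∀ i, (i ∈ A ↔ i ∈ B) → e i = i := by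
  classical
  induction hn : #(A \ B) generalizing B with
  | zero =>
    obtain rfl : A = B :=
      eq_of_subset_of_card_le (sdiff_eq_empty_iff_subset.mp (card_eq_zero.mp hn)) hcard.ge
    exact ⟨1, fun _ => Iff.rfl, fun _ _ => rfl⟩
  | succ n ih =>
    obtain ⟨x, hx⟩ : (A \ B).Nonempty := card_pos.mp (by omega)
    obtain ⟨y, hy⟩ : (B \ A).Nonempty := card_pos.mp (by rw [← card_sdiff_comm hcard]; omega)
    obtain ⟨hxA, hxB⟩ := mem_sdiff.mp hx
    obtain ⟨hyB, hyA⟩ := mem_sdiff.mp hy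
    have hxy : x ≠ y := fun hxy => hyA (hxy ▸ hxA)
    have hdiff : A \ insert x (B.erase y) = (A \ B).erase x := by
      ext i
      have hiy : i ∈ A → i ≠ y := fun hi hiy => hyA (hiy ▸ hi)
      simp only [mem_sdiff, mem_insert, mem_erase]
      tauto
    obtain ⟨e, hmem, heq⟩ := ih (B := insert x (B.erase y))
      (by rw [card_insert_of_notMem (fun hx => hxB (mem_of_mem_erase hx)),
        card_erase_add_one hyB, hcard])
      (by rw [hdiff, card_erase_of_mem hx, hn, Nat.add_sub_cancel])
    refine ⟨Equiv.swap x y * e, fun i => ?_, fun i hi => ?_⟩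
    · rw [← hmem i, Equiv.Perm.mul_apply]
      rcases eq_or_ne (e i) x with hx | hx
      · simp [hx, hyB]
      rcases eq_or_ne (e i) y with hy | hy
      · simp [hy, hxB, hxy.symm]
      simp [Equiv.swap_apply_of_ne_of_ne hx hy, hx, hy]
    · have hix : i ≠ x := by rintro rfl; exact hxB (hi.mp hxA)
      have hiy : i ≠ y := by rintro rfl; exact hyA (hi.mpr hyB)
      rw [Equiv.Perm.mul_apply, heq i (by simpa [hix, hiy] using hi)]
      exact Equiv.swap_apply_of_ne_of_ne hix hiy

theorem apply_mem_of_support_subset {L : Finset ι} {e : Equiv.Perm ι} (he : {i | e i ≠ i} ⊆ L)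
    {i : ι} (hi : i ∈ L) : e i ∈ L := by
  by_cases h : e i = i
  · rwa [h]
  · exact he fun heq => h (e.injective heq)

/-- `o` assigns servers of `S` to the requests in `L` and uses up the capacities `c`. -/
structure IsSaturating (S : Finset ℝ) (c : ℝ → ℕ) (L : Finset ι) (o : ι → ℝ) : Prop where
  mem : ∀ i ∈ L, o i ∈ S
  card_eq : ∀ s ∈ S, #{i ∈ L | o i = s} = c s

namespace IsSaturating

variable {S T : Finset ℝ} {c : ℝ → ℕ} {L : Finset ι} {a o : ι → ℝ}

theorem card_filter_mem (ho : IsSaturating S c L o) (hT : T ⊆ S) :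
    #{i ∈ L | o i ∈ T} = ∑ s ∈ T, c s := by
  rw [← sum_card_fiberwise_eq_card_filter]
  exact sum_congr rfl fun s hs => ho.card_eq s (hT hs)

theorem card_eq_sum (ho : IsSaturating S c L o) : #L = ∑ s ∈ S, c s := by
  rw [← ho.card_filter_mem subset_rfl, filter_true_of_mem ho.mem]

theorem restrict (ho : IsSaturating S c L o) (hT : T ⊆ S) :
    IsSaturating T c {i ∈ L | o i ∈ T} o where
  mem _ hi := (mem_filter.mp hi).2
  card_eq s hs := by
    rw [filter_filter, ← ho.card_eq s (hT hs)]
    congr 1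
    exact filter_congr fun i _ => and_iff_right_of_imp fun h => h ▸ hs

theorem comp_perm (ho : IsSaturating S c L o) {e : Equiv.Perm ι} (he : {i | e i ≠ i} ⊆ L) :
    IsSaturating S c L (o ∘ e) where
  mem _ hi := ho.mem _ (apply_mem_of_support_subset he hi)
  card_eq s hs := by
    rw [← ho.card_eq s hs, card_filter, card_filter]
    exact e.sum_comp L (fun i => if o i = s then 1 else 0) he

theorem exists_rearrangement (ha : IsSaturating S c L a) (ho : IsSaturating S c L o) (hT : T ⊆ S) :
    ∃ o' : ι → ℝ, IsSaturating S c L o' ∧ (∀ i ∈ L, (o' i ∈ T ↔ a i ∈ T)) ∧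
      (∀ i ∈ L, (o' i ∈ T ↔ o i ∈ T) → o' i = o i) ∧ ∑ i ∈ L, o' i = ∑ i ∈ L, o i := by
  obtain ⟨e, hmem, heq⟩ := exists_perm_of_card_eq
    ((ha.card_filter_mem hT).trans (ho.card_filter_mem hT).symm)
  simp only [mem_filter] at hmem heq
  have he : {i | e i ≠ i} ⊆ (L : Set ι) := fun i hi => by
    by_contra hiL
    exact hi (heq i (iff_of_false (fun h => hiL h.1) fun h => hiL h.1))
  have hiff : ∀ i ∈ L, (o (e i) ∈ T ↔ a i ∈ T) := fun i hi => by
    simpa [hi, apply_mem_of_support_subset he hi] using hmem i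
  refine ⟨o ∘ e, ho.comp_perm he, hiff, fun i hi hio => ?_, e.sum_comp L o he⟩
  rw [Function.comp_apply, heq i]
  simpa [hi, ← hiff i hi] using hio

end IsSaturating

end Rearrangement

section Run

open Finset

variable {ι : Type*} [LinearOrder ι]

/-- The servers that are still free when request `i` arrives, if the requests in `L` arrive in
increasing order and each `j ∈ L` is matched with `a j`. -/
noncomputable def freeAt (S : Finset ℝ) (c : ℝ → ℕ) (L : Finset ι) (a : ι → ℝ) (i : ι) : Finset ℝ :=
  freeServers S fun s => c s - #{j ∈ L | j < i ∧ a j = s}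

/-- The rule `A` matches the requests `r i`, for `i ∈ L` in increasing order, with the servers
`a i`, each of which is free at that moment. This is the form of `assignment` that restricts to
subsets of the servers. -/
structure IsRun (A : ℝ → Finset ℝ → ℝ) (S : Finset ℝ) (c : ℝ → ℕ) (L : Finset ι) (r a : ι → ℝ) :
    Prop where
  apply_eq : ∀ i ∈ L, A (r i) (freeAt S c L a i) = a i
  mem_freeAt : ∀ i ∈ L, a i ∈ freeAt S c L a i

variable {S T : Finset ℝ} {c : ℝ → ℕ} {L : Finset ι} {r a : ι → ℝ} {A A' : ℝ → Finset ℝ → ℝ}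

theorem mem_freeAt_iff {i : ι} {s : ℝ} :
    s ∈ freeAt S c L a i ↔ s ∈ S ∧ #{j ∈ L | j < i ∧ a j = s} < c s := by
  rw [freeAt, freeServers, mem_filter, tsub_pos_iff_lt]

theorem freeAt_subset (i : ι) : freeAt S c L a i ⊆ S := filter_subset _ _

theorem freeAt_antitone : Antitone (freeAt S c L a) := fun i j hij s hs => by
  rw [mem_freeAt_iff] at hs ⊢
  refine ⟨hs.1, (card_le_card fun k hk => ?_).trans_lt hs.2⟩
  simp only [mem_filter] at hk ⊢
  exact ⟨hk.1, hk.2.1.trans_le hij, hk.2.2⟩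

theorem freeAt_nonempty {i : ι} (hi : #{j ∈ L | j < i} < ∑ s ∈ S, c s) :
    (freeAt S c L a i).Nonempty := by
  by_contra! hempty
  refine hi.not_ge ?_
  calc ∑ s ∈ S, c s ≤ ∑ s ∈ S, #{j ∈ L | j < i ∧ a j = s} :=
        sum_le_sum fun s hs => not_lt.mp fun hlt =>
          notMem_empty s (hempty ▸ mem_freeAt_iff.mpr ⟨hs, hlt⟩)
    _ = #{j ∈ L | j < i ∧ a j ∈ S} := by
        simp only [← filter_filter, sum_card_fiberwise_eq_card_filter]
    _ ≤ #{j ∈ L | j < i} := card_le_card (monotone_filter_right L fun _ _ hj => hj.1)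

theorem freeAt_restrict (hT : T ⊆ S) (i : ι) :
    freeAt T c {j ∈ L | a j ∈ T} a i = freeAt S c L a i ∩ T := by
  ext s
  rw [mem_inter, mem_freeAt_iff, mem_freeAt_iff, filter_filter]
  by_cases hs : s ∈ T
  · have hfilter : {j ∈ L | a j ∈ T ∧ j < i ∧ a j = s} = {j ∈ L | j < i ∧ a j = s} :=
      filter_congr fun j _ => and_iff_right_of_imp fun h => h.2 ▸ hs
    simp only [hfilter, hs, hT hs, true_and, and_true]
  · simp only [hs, false_and, and_false]

namespace IsRun

theorem mem (h : IsRun A S c L r a) {i : ι} (hi : i ∈ L) : a i ∈ S :=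
  freeAt_subset i (h.mem_freeAt i hi)

theorem card_filter_eq_le (h : IsRun A S c L r a) (s : ℝ) : #{i ∈ L | a i = s} ≤ c s := by
  rcases ({i ∈ L | a i = s} : Finset ι).eq_empty_or_nonempty with hempty | hne
  · simp [hempty]
  obtain ⟨hmax, hs⟩ := mem_filter.mp (max'_mem _ hne)
  set last := max' _ hne
  have hlast : {i ∈ L | a i = s} ⊆ insert last {j ∈ L | j < last ∧ a j = s} := fun i hi => by
    rcases (le_max' _ i hi).eq_or_lt with heq | hlt
    · exact mem_insert.mpr (Or.inl heq)
    · obtain ⟨hiL, his⟩ := mem_filter.mp hi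
      exact mem_insert_of_mem (mem_filter.mpr ⟨hiL, hlt, his⟩)
  have hfree := (mem_freeAt_iff.mp (h.mem_freeAt last hmax)).2
  rw [hs] at hfree
  exact (card_le_card hlast).trans ((card_insert_le _ _).trans hfree)

theorem isSaturating (h : IsRun A S c L r a) (hcard : #L = ∑ s ∈ S, c s) :
    IsSaturating S c L a where
  mem _ := h.mem
  card_eq := by
    refine (sum_eq_sum_iff_of_le fun s _ => h.card_filter_eq_le s).mp ?_
    have hmaps : Set.MapsTo a (L : Set ι) (S : Set ℝ) := fun i hi => h.mem hi
    rw [← hcard, ← card_eq_sum_card_fiberwise hmaps]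

theorem restrict (h : IsRun A S c L r a) (hT : T ⊆ S)
    (hA : ∀ i ∈ L, a i ∈ T → a i = A' (r i) (freeAt S c L a i ∩ T)) :
    IsRun A' T c {i ∈ L | a i ∈ T} r a where
  apply_eq i hi := by
    rw [freeAt_restrict hT]
    exact (hA i (mem_filter.mp hi).1 (mem_filter.mp hi).2).symm
  mem_freeAt i hi := by
    rw [freeAt_restrict hT]
    exact mem_inter.mpr ⟨h.mem_freeAt i (mem_filter.mp hi).1, (mem_filter.mp hi).2⟩

theorem congr (h : IsRun A S c L r a) (hA : ∀ x, ∀ F ⊆ S, A x F = A' x F) :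
    IsRun A' S c L r a where
  apply_eq i hi := by rw [← hA _ _ (freeAt_subset i), h.apply_eq i hi]
  mem_freeAt := h.mem_freeAt

end IsRun

end Run

section Sides

open Finset

variable {S₁ S₂ : Finset ℝ} {ρ m u v M s : ℝ}

theorem disjoint_of_le_of_lt (h₁ : ∀ s ∈ S₁, s ≤ u) (h₂ : ∀ s ∈ S₂, u < s) : Disjoint S₁ S₂ :=
  disjoint_left.mpr fun s hs₁ hs₂ => (h₂ s hs₂).not_ge (h₁ s hs₁)

theorem mem_right_iff_notMem_left (hdisj : Disjoint S₁ S₂) (hs : s ∈ S₁ ∪ S₂) :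
    s ∈ S₂ ↔ s ∉ S₁ :=
  ⟨fun hs₂ hs₁ => disjoint_left.mp hdisj hs₁ hs₂, (mem_union.mp hs).resolve_left⟩

theorem mem_right_iff_lt (h₁ : ∀ s ∈ S₁, s ≤ u) (h₂ : ∀ s ∈ S₂, u < s) (hs : s ∈ S₁ ∪ S₂) :
    s ∈ S₂ ↔ u < s :=
  ⟨h₂ s, fun hus => (mem_union.mp hs).resolve_left fun hs₁ => hus.not_ge (h₁ s hs₁)⟩

theorem mem_left_iff_le (h₁ : ∀ s ∈ S₁, s ≤ u) (h₂ : ∀ s ∈ S₂, u < s) (hs : s ∈ S₁ ∪ S₂) :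
    s ∈ S₁ ↔ s ≤ u :=
  ⟨h₁ s, fun hsu => (mem_union.mp hs).resolve_right fun hs₂ => (h₂ s hs₂).not_ge hsu⟩

variable {ι : Type*} {L : Finset ι} {r o : ι → ℝ}

theorem sum_filter_mem_add_sum_filter_mem (hdisj : Disjoint S₁ S₂) (ho : ∀ i ∈ L, o i ∈ S₁ ∪ S₂)
    (f : ι → ℝ) : ∑ i ∈ L with o i ∈ S₁, f i + ∑ i ∈ L with o i ∈ S₂, f i = ∑ i ∈ L, f i := by
  rw [filter_congr fun i hi => mem_right_iff_notMem_left hdisj (ho i hi),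
    sum_filter_add_sum_filter_not]

theorem sum_charge_add_sum_charge (h₁ : ∀ s ∈ S₁, s ≤ u) (h₂ : ∀ s ∈ S₂, u < s)
    (ho : ∀ i ∈ L, o i ∈ S₁ ∪ S₂) :
    ∑ i ∈ L with o i ∈ S₁, charge ρ m u (r i) (o i) +
      ∑ i ∈ L with o i ∈ S₂, charge ρ v M (r i) (o i) =
      ∑ i ∈ L, splitCharge ρ m u v M (r i) (o i) := by
  rw [← sum_filter_mem_add_sum_filter_mem (disjoint_of_le_of_lt h₁ h₂) ho]
  refine congrArg₂ (· + ·) (sum_congr rfl fun i hi => ?_) (sum_congr rfl fun i hi => ?_)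
  · rw [splitCharge, if_pos (h₁ _ (mem_filter.mp hi).2)]
  · rw [splitCharge, if_neg (h₂ _ (mem_filter.mp hi).2).not_ge]

end Sides

section ThresholdRule

open Finset

open Classical in
/-- The rule that serves requests up to `κ` by the rule `A₁` on the servers `S₁` and other requests
by the rule `A₂` on the servers `S₂`, except that a side without free servers is never chosen. -/
noncomputable def thresholdRule (κ : ℝ) (S₁ S₂ : Finset ℝ) (A₁ A₂ : ℝ → Finset ℝ → ℝ) (r : ℝ)
    (F : Finset ℝ) : ℝ :=
  if (r ≤ κ ∧ F ∩ S₁ ≠ ∅) ∨ F ∩ S₂ = ∅ then A₁ r (F ∩ S₁) else A₂ r (F ∩ S₂)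

variable {κ : ℝ} {S S₁ S₂ : Finset ℝ} {A A' A₁ A₂ : ℝ → Finset ℝ → ℝ}

theorem thresholdRule_cases (hA₁ : IsOnlineRule S₁ A₁) (hA₂ : IsOnlineRule S₂ A₂) {F : Finset ℝ}
    (hF : F ⊆ S₁ ∪ S₂) (hne : F.Nonempty) (r : ℝ) :
    (thresholdRule κ S₁ S₂ A₁ A₂ r F ∈ F ∩ S₁ ∧
      thresholdRule κ S₁ S₂ A₁ A₂ r F = A₁ r (F ∩ S₁) ∧ (κ < r → F ∩ S₂ = ∅)) ∨
    (thresholdRule κ S₁ S₂ A₁ A₂ r F ∈ F ∩ S₂ ∧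
      thresholdRule κ S₁ S₂ A₁ A₂ r F = A₂ r (F ∩ S₂) ∧ (r ≤ κ → F ∩ S₁ = ∅)) := by
  by_cases h : (r ≤ κ ∧ F ∩ S₁ ≠ ∅) ∨ F ∩ S₂ = ∅
  · have hne₁ : (F ∩ S₁).Nonempty := by
      rcases h with h | h
      · exact nonempty_iff_ne_empty.mpr h.2
      · rwa [← inter_eq_left.mpr hF, inter_union_distrib_left, h, union_empty] at hne
    rw [thresholdRule, if_pos h]
    exact Or.inl ⟨hA₁ r _ inter_subset_right hne₁, rfl,
      fun hr => h.resolve_left fun h => hr.not_ge h.1⟩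
  · rw [thresholdRule, if_neg h]
    rw [not_or, not_and_not_right] at h
    exact Or.inr ⟨hA₂ r _ inter_subset_right (nonempty_iff_ne_empty.mpr h.2), rfl, h.1⟩

theorem isOnlineRule_thresholdRule (hA₁ : IsOnlineRule S₁ A₁) (hA₂ : IsOnlineRule S₂ A₂) :
    IsOnlineRule (S₁ ∪ S₂) (thresholdRule κ S₁ S₂ A₁ A₂) := fun r _ hF hne =>
  (thresholdRule_cases hA₁ hA₂ hF hne r).elim (fun h => (mem_inter.mp h.1).1)
    fun h => (mem_inter.mp h.1).1

theorem thresholdRule_singleton {r s : ℝ} (hs : s ∈ S₁ ∪ S₂) (hA₁ : A₁ r {s} = s)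
    (hA₂ : A₂ r {s} = s) : thresholdRule κ S₁ S₂ A₁ A₂ r {s} = s := by
  rw [thresholdRule]
  by_cases hs₁ : s ∈ S₁ <;> by_cases hs₂ : s ∈ S₂ <;> simp_all

variable {ι : Type*} [LinearOrder ι] {c : ℝ → ℕ} {L : Finset ι} {r a : ι → ℝ}

section Restrict

variable (hA₁ : IsOnlineRule S₁ A₁) (hA₂ : IsOnlineRule S₂ A₂) (hdisj : Disjoint S₁ S₂)
  (hrun : IsRun (thresholdRule κ S₁ S₂ A₁ A₂) (S₁ ∪ S₂) c L r a)
include hA₁ hA₂ hdisj hrun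

theorem IsRun.eq_left_of_thresholdRule {i : ι} (hi : i ∈ L) (hai : a i ∈ S₁) :
    a i = A₁ (r i) (freeAt (S₁ ∪ S₂) c L a i ∩ S₁) ∧
      (κ < r i → freeAt (S₁ ∪ S₂) c L a i ∩ S₂ = ∅) := by
  have hcases := thresholdRule_cases (κ := κ) hA₁ hA₂ (freeAt_subset i)
    ⟨_, hrun.mem_freeAt i hi⟩ (r i)
  rw [hrun.apply_eq i hi] at hcases
  exact (hcases.resolve_right fun h => disjoint_left.mp hdisj hai (mem_inter.mp h.1).2).2

theorem IsRun.eq_right_of_thresholdRule {i : ι} (hi : i ∈ L) (hai : a i ∈ S₂) :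
    a i = A₂ (r i) (freeAt (S₁ ∪ S₂) c L a i ∩ S₂) ∧
      (r i ≤ κ → freeAt (S₁ ∪ S₂) c L a i ∩ S₁ = ∅) := by
  have hcases := thresholdRule_cases (κ := κ) hA₁ hA₂ (freeAt_subset i)
    ⟨_, hrun.mem_freeAt i hi⟩ (r i)
  rw [hrun.apply_eq i hi] at hcases
  exact (hcases.resolve_left fun h => disjoint_left.mp hdisj (mem_inter.mp h.1).2 hai).2

theorem IsRun.restrict_left_of_thresholdRule : IsRun A₁ S₁ c {i ∈ L | a i ∈ S₁} r a :=
  hrun.restrict subset_union_left fun _ hi hai =>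
    (hrun.eq_left_of_thresholdRule hA₁ hA₂ hdisj hi hai).1

theorem IsRun.restrict_right_of_thresholdRule : IsRun A₂ S₂ c {i ∈ L | a i ∈ S₂} r a :=
  hrun.restrict subset_union_right fun _ hi hai =>
    (hrun.eq_right_of_thresholdRule hA₁ hA₂ hdisj hi hai).1

/- Of an overflow to the left and one to the right, the later one uses a server of a side that was
already exhausted when the earlier one arrived. -/
theorem IsRun.overflow_of_thresholdRule :
    (∀ i ∈ L, a i ∈ S₁ → r i ≤ κ) ∨ ∀ i ∈ L, a i ∈ S₂ → κ < r i := by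
  by_contra! hoverflow
  obtain ⟨⟨i, hi, hai, hri⟩, j, hj, haj, hrj⟩ := hoverflow
  have hemptyi := (hrun.eq_left_of_thresholdRule hA₁ hA₂ hdisj hi hai).2 hri
  have hemptyj := (hrun.eq_right_of_thresholdRule hA₁ hA₂ hdisj hj haj).2 hrj
  rcases le_total i j with hij | hji
  · have hmem := mem_inter.mpr ⟨freeAt_antitone hij (hrun.mem_freeAt j hj), haj⟩
    exact notMem_empty _ (hemptyi ▸ hmem)
  · have hmem := mem_inter.mpr ⟨freeAt_antitone hji (hrun.mem_freeAt i hi), hai⟩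
    exact notMem_empty _ (hemptyj ▸ hmem)

end Restrict

/-- Every run of the rule `A` that uses up the capacities costs at most the charges of its requests
with parameters `ρ`, `m`, `M`, for every choice of reserved servers within the capacities. -/
def IsChargeBounded (ι : Type*) [LinearOrder ι] (ρ m M : ℝ) (S : Finset ℝ) (c : ℝ → ℕ)
    (A : ℝ → Finset ℝ → ℝ) : Prop :=
  ∀ (L : Finset ι) (r a o : ι → ℝ), IsRun A S c L r a → IsSaturating S c L o →
    ∑ i ∈ L, |r i - a i| ≤ ∑ i ∈ L, charge ρ m M (r i) (o i)

variable {ρ m u v M : ℝ}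

theorem IsChargeBounded.congr (h : IsChargeBounded ι ρ m M S c A)
    (hA : ∀ x, ∀ F ⊆ S, A' x F = A x F) : IsChargeBounded ι ρ m M S c A' :=
  fun L r a o hrun ho => h L r a o (hrun.congr hA) ho

theorem isChargeBounded_thresholdRule (hκ : IsBalancedThreshold ρ m u κ v M)
    (hS₁ : ∀ s ∈ S₁, s ∈ Set.Icc m u) (hS₂ : ∀ s ∈ S₂, s ∈ Set.Icc v M)
    (hA₁ : IsOnlineRule S₁ A₁) (hA₂ : IsOnlineRule S₂ A₂)
    (h₁ : IsChargeBounded ι ρ m u S₁ c A₁) (h₂ : IsChargeBounded ι ρ v M S₂ c A₂) :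
    IsChargeBounded ι ρ m M (S₁ ∪ S₂) c (thresholdRule κ S₁ S₂ A₁ A₂) := by
  intro L r a o hrun ho
  have hIcc : ∀ s ∈ S₁ ∪ S₂, s ∈ Set.Icc m u ∪ Set.Icc v M := fun s hs =>
    (mem_union.mp hs).imp (hS₁ s) (hS₂ s)
  have hle : ∀ s ∈ S₁, s ≤ u := fun s hs => (hS₁ s hs).2
  have hlt : ∀ s ∈ S₂, u < s := fun s hs => hκ.left_lt_right.trans_le (hS₂ s hs).1
  have hdisj := disjoint_of_le_of_lt hle hlt
  obtain ⟨o', ho', hside, heq, hsum⟩ :=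
    (hrun.isSaturating ho.card_eq_sum).exists_rearrangement ho subset_union_left
  have hside₂ : ∀ i ∈ L, (o' i ∈ S₂ ↔ a i ∈ S₂) := fun i hi => by
    rw [mem_right_iff_notMem_left hdisj (ho'.mem i hi), hside i hi,
      mem_right_iff_notMem_left hdisj (hrun.mem hi)]
  have hr : (∀ i ∈ L, o' i ≤ u → r i ≤ κ) ∨ ∀ i ∈ L, u < o' i → κ ≤ r i := by
    refine (hrun.overflow_of_thresholdRule hA₁ hA₂ hdisj).imp (fun h i hi ho'i => h i hi ?_)
      fun h i hi ho'i => (h i hi ?_).le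
    · exact (hside i hi).mp ((mem_left_iff_le hle hlt (ho'.mem i hi)).mpr ho'i)
    · exact (hside₂ i hi).mp ((mem_right_iff_lt hle hlt (ho'.mem i hi)).mpr ho'i)
  calc ∑ i ∈ L, |r i - a i|
      = ∑ i ∈ L with a i ∈ S₁, |r i - a i| + ∑ i ∈ L with a i ∈ S₂, |r i - a i| :=
        (sum_filter_mem_add_sum_filter_mem hdisj (fun _ => hrun.mem) _).symm
    _ ≤ ∑ i ∈ L with a i ∈ S₁, charge ρ m u (r i) (o' i) +
        ∑ i ∈ L with a i ∈ S₂, charge ρ v M (r i) (o' i) :=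
        add_le_add
          (h₁ _ r a o' (hrun.restrict_left_of_thresholdRule hA₁ hA₂ hdisj)
            (filter_congr hside ▸ ho'.restrict subset_union_left))
          (h₂ _ r a o' (hrun.restrict_right_of_thresholdRule hA₁ hA₂ hdisj)
            (filter_congr hside₂ ▸ ho'.restrict subset_union_right))
    _ = ∑ i ∈ L, splitCharge ρ m u v M (r i) (o' i) := by
        rw [← filter_congr hside, ← filter_congr hside₂, sum_charge_add_sum_charge hle hlt ho'.mem]
    _ ≤ ∑ i ∈ L, charge ρ m M (r i) (o i) := by
        refine hκ.sum_splitCharge_le hr (fun i hi => hIcc _ (ho.mem i hi))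
          (fun i hi => hIcc _ (ho'.mem i hi)) (fun i hi hio => heq i hi ?_) hsum
        rwa [mem_left_iff_le hle hlt (ho'.mem i hi), mem_left_iff_le hle hlt (ho.mem i hi)]

end ThresholdRule

section Gap

variable {S : Finset ℝ} {u v m M ρ : ℝ}

theorem AdjacentIn.leftPart_union_rightPart (h : AdjacentIn S u v) :
    leftPart S u ∪ rightPart S v = S := by
  rw [leftPart, rightPart, ← Finset.filter_or]
  exact Finset.filter_true_of_mem h.2.2.2

theorem AdjacentIn.isGreatest_leftPart (h : AdjacentIn S u v) :
    IsGreatest (leftPart S u : Set ℝ) u :=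
  ⟨Finset.mem_filter.mpr ⟨h.1, le_rfl⟩, fun _ hs => (Finset.mem_filter.mp hs).2⟩

theorem AdjacentIn.isLeast_rightPart (h : AdjacentIn S u v) : IsLeast (rightPart S v : Set ℝ) v :=
  ⟨Finset.mem_filter.mpr ⟨h.2.1, le_rfl⟩, fun _ hs => (Finset.mem_filter.mp hs).2⟩

theorem AdjacentIn.isLeast_leftPart (h : AdjacentIn S u v) (hm : IsLeast (S : Set ℝ) m) :
    IsLeast (leftPart S u : Set ℝ) m :=
  ⟨Finset.mem_filter.mpr ⟨hm.1, hm.2 h.1⟩, fun _ hs => hm.2 (Finset.mem_filter.mp hs).1⟩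

theorem AdjacentIn.isGreatest_rightPart (h : AdjacentIn S u v) (hM : IsGreatest (S : Set ℝ) M) :
    IsGreatest (rightPart S v : Set ℝ) M :=
  ⟨Finset.mem_filter.mpr ⟨hM.1, hM.2 h.2.1⟩, fun _ hs => hM.2 (Finset.mem_filter.mp hs).1⟩

theorem IsLargestGap.maxGap_eq (h : IsLargestGap S u v) : maxGap S = v - u :=
  IsGreatest.csSup_eq ⟨⟨u, v, h.1, rfl⟩, by rintro _ ⟨u', v', h', rfl⟩; exact h.2 _ _ h'⟩

theorem IsLargestGap.diamGapRatio_eq (h : IsLargestGap S u v) (hm : IsLeast (S : Set ℝ) m)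
    (hM : IsGreatest (S : Set ℝ) M) : diamGapRatio S = (M - m) / (v - u) := by
  have hcard : 1 < S.card := Finset.one_lt_card.mpr ⟨u, h.1.1, v, h.1.2.1, h.1.2.2.1.ne⟩
  rw [diamGapRatio, dif_pos hcard, h.maxGap_eq, (Finset.isLeast_min' S _).unique hm,
    (Finset.isGreatest_max' S _).unique hM]

theorem criticalPoint_sub_left (hS : S.Nonempty) (hm : IsLeast (S : Set ℝ) m)
    (hM : IsGreatest (S : Set ℝ) M) :
    criticalPoint S hS u v - u = (M - u) / (v - m + (M - u)) * (v - u) := by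
  simp only [criticalPoint, (Finset.isLeast_min' S _).unique hm,
    (Finset.isGreatest_max' S _).unique hM]
  ring_nf

theorem IsLargestGap.isBalancedThreshold_criticalPoint (h : IsLargestGap S u v) (hS : S.Nonempty)
    (hm : IsLeast (S : Set ℝ) m) (hM : IsGreatest (S : Set ℝ) M)
    (hρ : 2 * diamGapRatio S + 1 ≤ ρ) :
    IsBalancedThreshold ρ m u (criticalPoint S hS u v) v M := by
  have huv := h.1.2.2.1
  have hmu : m ≤ u := hm.2 h.1.1
  have hvM : v ≤ M := hM.2 h.1.2.1
  have hD : 0 < v - u := sub_pos.mpr huv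
  have hp : 0 < v - m := by linarith
  have hq : 0 < M - u := by linarith
  have hleft := criticalPoint_sub_left (u := u) (v := v) hS hm hM
  have hright : v - criticalPoint S hS u v = (v - m) / (v - m + (M - u)) * (v - u) := by
    rw [← sub_sub_sub_cancel_right v _ u, hleft]
    field_simp
    ring
  have hρ' : 2 * (v - m + (M - u)) / (v - u) ≤ ρ + 1 :=
    calc 2 * (v - m + (M - u)) / (v - u) = 2 * ((M - m) / (v - u)) + 2 := by field_simp; ring
      _ ≤ ρ + 1 := by rw [← h.diamGapRatio_eq hm hM]; linarith
  have hoverflow : ∀ p ≥ 0, 2 * p ≤ (ρ + 1) * (p / (v - m + (M - u)) * (v - u)) := fun p hp₀ =>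
    calc 2 * p = 2 * (v - m + (M - u)) / (v - u) * (p / (v - m + (M - u)) * (v - u)) := by
          field_simp
      _ ≤ _ := by gcongr
  exact {
    le_left := hmu
    left_le := sub_nonneg.mp (hleft ▸ by positivity)
    left_lt_right := huv
    le_right := sub_nonneg.mp (hright ▸ by positivity)
    right_le := hvM
    overflow_left := hright ▸ hoverflow _ hp.le
    overflow_right := hleft ▸ hoverflow _ hq.le }

theorem one_le_of_forall_diamGapRatio (hρ : ∀ T ⊆ S, 2 * diamGapRatio T + 1 ≤ ρ) : 1 ≤ ρ := by
  simpa [diamGapRatio] using hρ ∅ (Finset.empty_subset S)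

theorem IsGapRule.induction {g : Finset ℝ → ℝ × ℝ} (hg : IsGapRule g) {P : Finset ℝ → Prop}
    (hsub : ∀ S, S.card ≤ 1 → P S)
    (hsplit : ∀ S, IsLargestGap S (g S).1 (g S).2 → P (leftPart S (g S).1) →
      P (rightPart S (g S).2) → P S) (S : Finset ℝ) : P S := by
  induction hn : S.card using Nat.strong_induction_on generalizing S with
  | _ n ih =>
    subst hn
    rcases le_or_gt S.card 1 with hcard | hcard
    · exact hsub S hcard
    · have h := hg S hcard
      exact hsplit S h (ih _ (card_leftPart_lt h) _ rfl) (ih _ (card_rightPart_lt h) _ rfl)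

end Gap

section PTCP

variable {g : Finset ℝ → ℝ × ℝ} {S : Finset ℝ} {ρ m M : ℝ}

theorem ptcp_singleton (g : Finset ℝ → ℝ × ℝ) (S : Finset ℝ) (r s : ℝ) : ptcp g S r {s} = s := by
  have h : ∃ s', ({s} : Finset ℝ) = {s'} := ⟨s, rfl⟩
  rw [ptcp, dif_pos h]
  exact (Finset.singleton_injective h.choose_spec).symm

theorem ptcp_eq_thresholdRule (h : IsLargestGap S (g S).1 (g S).2) {F : Finset ℝ} (hF : F ⊆ S)
    (r : ℝ) :
    ptcp g S r F = thresholdRule (criticalPoint S ⟨_, h.1.1⟩ (g S).1 (g S).2)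
      (leftPart S (g S).1) (rightPart S (g S).2) (ptcp g (leftPart S (g S).1))
      (ptcp g (rightPart S (g S).2)) r F := by
  by_cases hsingle : ∃ s, F = {s}
  · obtain ⟨s, rfl⟩ := hsingle
    have hs : s ∈ leftPart S (g S).1 ∪ rightPart S (g S).2 := by
      rw [h.1.leftPart_union_rightPart]
      exact Finset.singleton_subset_iff.mp hF
    rw [ptcp_singleton, thresholdRule_singleton hs (ptcp_singleton ..) (ptcp_singleton ..)]
  · rw [ptcp, dif_neg hsingle, dif_pos h, thresholdRule]

theorem isOnlineRule_ptcp (hg : IsGapRule g) (S : Finset ℝ) : IsOnlineRule S (ptcp g S) := by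
  induction S using hg.induction with
  | hsub S hS =>
    intro r F hF hne
    obtain ⟨s, rfl⟩ := Finset.card_eq_one.mp
      (((Finset.card_le_card hF).trans hS).antisymm hne.card_pos)
    rw [ptcp_singleton]
    exact Finset.mem_singleton_self s
  | hsplit S h hleft hright =>
    intro r F hF hne
    rw [ptcp_eq_thresholdRule h hF]
    exact isOnlineRule_thresholdRule hleft hright r F
      (h.1.leftPart_union_rightPart.symm ▸ hF) hne

theorem isChargeBounded_ptcp (hg : IsGapRule g) {ι : Type*} [LinearOrder ι] {c : ℝ → ℕ}
    (hρ : ∀ T ⊆ S, 2 * diamGapRatio T + 1 ≤ ρ) (hm : IsLeast (S : Set ℝ) m)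
    (hM : IsGreatest (S : Set ℝ) M) : IsChargeBounded ι ρ m M S c (ptcp g S) := by
  induction S using hg.induction generalizing m M with
  | hsub S hS =>
    intro L r a o hrun ho
    refine Finset.sum_le_sum fun i hi => ?_
    rw [Finset.card_le_one.mp hS _ (hrun.mem hi) _ (ho.mem i hi)]
    exact abs_sub_le_charge (one_le_of_forall_diamGapRatio hρ) (hm.2 (ho.mem i hi))
      (hM.2 (ho.mem i hi))
  | hsplit S h hleft hright =>
    have hthreshold := h.isBalancedThreshold_criticalPoint ⟨_, h.1.1⟩ hm hM (hρ S subset_rfl)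
    have hleft_least := h.1.isLeast_leftPart hm
    have hleft_greatest := h.1.isGreatest_leftPart
    have hright_least := h.1.isLeast_rightPart
    have hright_greatest := h.1.isGreatest_rightPart hM
    have hbound := isChargeBounded_thresholdRule hthreshold
      (fun s hs => ⟨hleft_least.2 hs, hleft_greatest.2 hs⟩)
      (fun s hs => ⟨hright_least.2 hs, hright_greatest.2 hs⟩)
      (isOnlineRule_ptcp hg _) (isOnlineRule_ptcp hg _)
      (hleft (fun T hT => hρ T (hT.trans (Finset.filter_subset _ S))) hleft_least hleft_greatest)
      (hright (fun T hT => hρ T (hT.trans (Finset.filter_subset _ S))) hright_least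
        hright_greatest)
    rw [h.1.leftPart_union_rightPart] at hbound
    exact hbound.congr fun r F hF => ptcp_eq_thresholdRule h hF r

end PTCP

section Assignment

open Finset

variable {A : ℝ → Finset ℝ → ℝ} {S : Finset ℝ} {c : ℝ → ℕ} {σ : List ℝ}

theorem count_take_eq_card_filter {α : Type*} [DecidableEq α] (l : List α) (d x : α) {i : ℕ}
    (hi : i ≤ l.length) : (l.take i).count x = #{j ∈ range i | l.getD j d = x} := by
  induction i with
  | zero => simp
  | succ i ih =>
    rw [List.take_succ_eq_append_getElem hi, List.count_append, ih (by omega), range_add_one,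
      filter_insert, List.getD_eq_getElem _ _ hi]
    split_ifs with h
    · rw [card_insert_of_notMem (by simp), h, List.count_singleton_self]
    · rw [List.count_singleton, if_neg (by simpa using h), add_zero]

theorem count_eq_card_filter {α : Type*} [DecidableEq α] (l : List α) (d x : α) :
    l.count x = #{j ∈ range l.length | l.getD j d = x} := by
  rw [← count_take_eq_card_filter l d x le_rfl, List.take_length]

theorem length_assignment (A : ℝ → Finset ℝ → ℝ) (S : Finset ℝ) (c : ℝ → ℕ) (σ : List ℝ) :
    (assignment A S c σ).length = σ.length := by
  induction σ generalizing c with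
  | nil => rfl
  | cons r σ ih => simp [assignment, ih]

theorem getElem_assignment (c : ℝ → ℕ) {i : ℕ} (hi : i < σ.length) :
    (assignment A S c σ)[i]'(by rwa [length_assignment]) =
      A σ[i] (freeServers S fun s => c s - ((assignment A S c σ).take i).count s) := by
  induction σ generalizing c i with
  | nil => simp at hi
  | cons r σ ih =>
    cases i with
    | zero => simp [assignment]
    | succ i =>
      simp only [assignment, List.getElem_cons_succ, List.take_succ_cons]
      rw [ih _ (Nat.lt_of_succ_lt_succ hi)]
      congr 2
      funext s
      rw [List.count_cons]
      rcases eq_or_ne s (A r (freeServers S c)) with rfl | hs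
      · rw [Function.update_self, if_pos (beq_self_eq_true _), Nat.sub_sub, Nat.add_comm]
      · rw [Function.update_of_ne hs, if_neg (by simpa using hs.symm), add_zero]

theorem freeAt_range_getD {l : List ℝ} {i : ℕ} (hi : i < l.length) :
    freeAt S c (range l.length) (l.getD · 0) i =
      freeServers S fun s => c s - (l.take i).count s := by
  have hfilter : {j ∈ range l.length | j < i} = range i := by
    ext j
    simp only [mem_filter, mem_range]
    omega
  simp only [freeAt, ← filter_filter, hfilter, count_take_eq_card_filter l 0 _ hi.le]

theorem isRun_assignment (hA : IsOnlineRule S A) (hlen : σ.length ≤ ∑ s ∈ S, c s) :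
    IsRun A S c (range σ.length) (σ.getD · 0) ((assignment A S c σ).getD · 0) := by
  have happly : ∀ i ∈ range σ.length,
      A (σ.getD i 0) (freeAt S c (range σ.length) ((assignment A S c σ).getD · 0) i) =
        (assignment A S c σ).getD i 0 := fun i hi => by
    rw [mem_range] at hi
    have hi' : i < (assignment A S c σ).length := by rwa [length_assignment]
    rw [← length_assignment A S c σ, freeAt_range_getD hi', List.getD_eq_getElem _ _ hi,
      List.getD_eq_getElem _ _ hi', getElem_assignment c hi]
  refine ⟨happly, fun i hi => happly i hi ▸ hA _ _ (freeAt_subset i) (freeAt_nonempty ?_)⟩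
  calc #{j ∈ range σ.length | j < i} < #(range σ.length) :=
        card_lt_card (filter_ssubset.mpr ⟨i, hi, lt_irrefl i⟩)
    _ ≤ ∑ s ∈ S, c s := by rwa [card_range]

theorem isFeasible_assignment (hA : IsOnlineRule S A) (hlen : σ.length ≤ ∑ s ∈ S, c s) :
    IsFeasible S c σ (assignment A S c σ) := by
  have hrun := isRun_assignment hA hlen
  refine ⟨length_assignment A S c σ, fun s hs => ?_, fun s _ => ?_⟩
  · obtain ⟨i, hi, rfl⟩ := List.mem_iff_getElem.mp hs
    rw [← List.getD_eq_getElem _ 0]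
    exact hrun.mem (mem_range.mpr (by rwa [length_assignment] at hi))
  · rw [count_eq_card_filter _ 0, length_assignment]
    exact hrun.card_filter_eq_le s

end Assignment

section Cost

open Finset

variable {S : Finset ℝ} {c : ℝ → ℕ} {σ τ : List ℝ}

theorem matchingCost_cons (r s : ℝ) (σ τ : List ℝ) :
    matchingCost (r :: σ) (s :: τ) = |r - s| + matchingCost σ τ := by
  rw [matchingCost, List.zipWith_cons_cons, List.sum_cons, matchingCost]

theorem matchingCost_nonneg (σ τ : List ℝ) : 0 ≤ matchingCost σ τ := by
  refine List.sum_nonneg fun x hx => ?_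
  obtain ⟨i, hi, rfl⟩ := List.mem_iff_getElem.mp hx
  rw [List.getElem_zipWith]
  exact abs_nonneg _

theorem matchingCost_append_self (h : τ.length = σ.length) (l : List ℝ) :
    matchingCost (σ ++ l) (τ ++ l) = matchingCost σ τ := by
  simp [matchingCost, List.zipWith_append h.symm]

theorem matchingCost_eq_sum (h : τ.length = σ.length) :
    matchingCost σ τ = ∑ i ∈ range σ.length, |σ.getD i 0 - τ.getD i 0| := by
  induction σ generalizing τ with
  | nil => simp [matchingCost]
  | cons r σ ih =>
    obtain ⟨s, τ, rfl⟩ := List.exists_cons_of_length_eq_add_one h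
    rw [matchingCost_cons, ih (Nat.succ.inj h), List.length_cons, sum_range_succ', add_comm]
    simp only [List.getD_cons_zero, List.getD_cons_succ]

theorem algCost_le_algCost_append (A : ℝ → Finset ℝ → ℝ) (S : Finset ℝ) (c : ℝ → ℕ)
    (σ l : List ℝ) : algCost A S c σ ≤ algCost A S c (σ ++ l) := by
  induction σ generalizing c with
  | nil => exact matchingCost_nonneg _ _
  | cons r σ ih =>
    simp only [algCost, assignment, List.cons_append, matchingCost_cons]
    exact add_le_add_right (ih _) _

theorem IsFeasible.exists_append (h : IsFeasible S c σ τ) :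
    ∃ l : List ℝ, (∀ s ∈ l, s ∈ S) ∧ ∀ s ∈ S, (τ ++ l).count s = c s := by
  set free : ℝ →₀ ℕ := Finsupp.indicator S fun s _ => c s - τ.count s with hfree
  have hcount : ∀ s, (Finsupp.toMultiset free).toList.count s = free s := fun s => by
    rw [← Multiset.coe_count, Multiset.coe_toList, Finsupp.count_toMultiset]
  refine ⟨(Finsupp.toMultiset free).toList, fun s hs => ?_, fun s hs => ?_⟩
  · by_contra hsS
    refine (List.count_pos_iff.mpr hs).ne' ?_
    rw [hcount, hfree, Finsupp.indicator_of_notMem hsS]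
  · rw [List.count_append, hcount, hfree, Finsupp.indicator_of_mem hs]
    exact Nat.add_sub_cancel' (h.2.2 s hs)

theorem isSaturating_getD (hmem : ∀ s ∈ τ, s ∈ S) (hcount : ∀ s ∈ S, τ.count s = c s) :
    IsSaturating S c (range τ.length) (τ.getD · 0) where
  mem i hi := by
    rw [List.getD_eq_getElem _ _ (mem_range.mp hi)]
    exact hmem _ (List.getElem_mem _)
  card_eq s hs := by rw [← count_eq_card_filter, hcount s hs]

theorem algCost_ptcp_le {g : Finset ℝ → ℝ × ℝ} (hg : IsGapRule g) {ρ : ℝ}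
    (hρ : ∀ T ⊆ S, 2 * diamGapRatio T + 1 ≤ ρ) (hS : S.Nonempty) (h : IsFeasible S c σ τ) :
    algCost (ptcp g S) S c σ ≤ ρ * matchingCost σ τ := by
  obtain ⟨l, hl, hcount⟩ := h.exists_append
  have hlen : (τ ++ l).length = (σ ++ l).length := by
    rw [List.length_append, h.1, List.length_append]
  have hsat := isSaturating_getD (fun s hs => (List.mem_append.mp hs).elim (h.2.1 s) (hl s)) hcount
  rw [hlen] at hsat
  have htotal : (σ ++ l).length ≤ ∑ s ∈ S, c s := by rw [← hsat.card_eq_sum, card_range]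
  have hcharge := isChargeBounded_ptcp hg hρ (isLeast_min' S hS) (isGreatest_max' S hS) _ _ _ _
    (isRun_assignment (isOnlineRule_ptcp hg S) htotal) hsat
  calc algCost (ptcp g S) S c σ
      ≤ algCost (ptcp g S) S c (σ ++ l) := algCost_le_algCost_append _ S c σ l
    _ = ∑ i ∈ range (σ ++ l).length,
          |(σ ++ l).getD i 0 - (assignment (ptcp g S) S c (σ ++ l)).getD i 0| :=
        matchingCost_eq_sum (length_assignment _ S c _)
    _ ≤ ∑ i ∈ range (σ ++ l).length, ρ * |(σ ++ l).getD i 0 - (τ ++ l).getD i 0| :=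
        hcharge.trans (sum_le_sum fun _ _ => charge_le_mul_abs_sub)
    _ = ρ * matchingCost σ τ := by
        rw [← mul_sum, ← matchingCost_eq_sum hlen, matchingCost_append_self h.1]

end Cost

theorem theorem1 (g : Finset ℝ → ℝ × ℝ) (hg : IsGapRule g) (S : Finset ℝ) (c : ℝ → ℕ) :
    IsOnlineRule S (ptcp g S) ∧ IsCompetitive S c (ptcp g S) (2 * alphaRatio S + 1) := by
  have hA := isOnlineRule_ptcp hg S
  have hα : ∀ T ⊆ S, 2 * diamGapRatio T + 1 ≤ 2 * alphaRatio S + 1 := fun T hT => by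
    gcongr
    exact Finset.le_sup' diamGapRatio (Finset.mem_powerset.mpr hT)
  have hρ : 0 < 2 * alphaRatio S + 1 := one_pos.trans_le (one_le_of_forall_diamGapRatio hα)
  refine ⟨hA, fun σ hσ => ?_⟩
  rw [← div_le_iff₀' hρ]
  refine le_csInf ⟨_, _, isFeasible_assignment hA hσ, rfl⟩ ?_
  rintro _ ⟨τ, hτ, rfl⟩
  rw [div_le_iff₀' hρ]
  rcases S.eq_empty_or_nonempty with rfl | hS
  · obtain rfl : σ = [] := by simpa using hσ
    simp [algCost, matchingCost]
  · exact algCost_ptcp_le hg hα hS hτ
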